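/- Let $\mathbb{F}_5$ be the field with five elements. An $[n,k,d]_5$ code is a $k$-dimensional subspace $C\subseteq\mathbb{F}_5^n$ with minimum Hamming distance $d$; it is a nontrivial MDS code if $2\le k\le n-2$ and $d=n-k+1$. Let $C^\perp$ be the dual of $C$ for the inner product $x\cdot y=\sum_i x_iy_i$; $C$ is self-dual if $C=C^\perp$. For $v\in\mathbb{F}_5^n$ put $d(v,C)=\min_{x\in C}d(v,x)$ and $B_{v,t}=|\{x\in C: d(v,x)=t\}|$, and let $\rho=\max_v d(v,C)$ be the covering radius. The code $C$ is completely regular (CR) if $B_{v,t}$ depends only on $t$ and $d(v,C)$, and uniformly packed in the wide sense (UPWS) if there are rational numbers $\beta_0,\dots,\beta_\rho$ with $\sum_{i=0}^{\rho}\beta_iB_{x,i}=1$ for all $x\in\mathbb{F}_5^n$. Two codes are equivalent if one is obtained from the other by permuting the coordinates and multiplying each coordinate by a nonzero scalar. **Theorem.** There are exactly six nontrivial MDS codes over $\mathbb{F}_5$ up to equivalence, one for each of the parameters $[6,4,3]$, $[6,2,5]$, $[6,3,4]$, $[5,3,3]$, $[5,2,4]$, $[4,2,3]$. That is, a nontrivial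 MDS $[n,k,d]_5$ code exists if and only if $[n,k,d]$ is one of these six, and any two nontrivial MDS codes over $\mathbb{F}_5$ with the same parameters are equivalent. Moreover: 1. Every $[6,4,3]_5$ code is CR. A code $C\subseteq\mathbb{F}_5^6$ is a $[6,4,3]_5$ code if and only if $C^\perp$ is a $[6,2,5]_5$ code. No $[6,2,5]_5$ code is UPWS. 2. No $[6,3,4]_5$ code is UPWS. There exists a self-dual $[6,3,4]_5$ code. 3. Every $[5,3,3]_5$ code is CR. A code $C\subseteq\mathbb{F}_5^5$ is a $[5,3,3]_5$ code if and only if $C^\perp$ is a $[5,2,4]_5$ code. Every $[5,2,4]_5$ code is UPWS. 4. Every $[4,2,3]_5$ code is CR, and none is self-dual. -/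

import Mathlib

namespace MDSCode

instance factPrimeFive : Fact (Nat.Prime 5) := ⟨by norm_num⟩

variable {F : Type*} [Field F] [Fintype F] [DecidableEq F] {n : ℕ}

/-- `C` is an `[n, k, d]` code over `F`: a `k`-dimensional subspace of `F ^ n` such that `d` is the
smallest Hamming distance between two distinct codewords. -/
structure IsLinearCode (C : Submodule F (Fin n → F)) (k d : ℕ) : Prop where
  finrank_eq : Module.finrank F C = k
  isLeast_dist : IsLeast {m : ℕ | ∃ x ∈ C, ∃ y ∈ C, x ≠ y ∧ hammingDist x y = m} d

/-- `C` is a nontrivial MDS `[n, k, d]` code: `2 ≤ k ≤ n - 2`, and the Singleton bound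
`d ≤ n - k + 1` is attained. -/
structure IsNontrivialMDS (C : Submodule F (Fin n → F)) (k d : ℕ) : Prop
    extends IsLinearCode C k d where
  two_le : 2 ≤ k
  add_two_le : k + 2 ≤ n
  singleton_eq : d + k = n + 1

/-- The Euclidean dual code. -/
def dualCode (C : Submodule F (Fin n → F)) : Submodule F (Fin n → F) where
  carrier := {x | ∀ v ∈ C, ∑ i, x i * v i = 0}
  add_mem' := by
    intro a b ha hb v hv
    simp only [Set.mem_ofPred_eq] at ha hb
    simp [add_mul, Finset.sum_add_distrib, ha v hv, hb v hv]
  zero_mem' := by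
    intro v _
    simp
  smul_mem' := by
    intro c x hx v hv
    simp only [Set.mem_ofPred_eq] at hx
    simp [mul_assoc, ← Finset.mul_sum, hx v hv]

/-- `C` coincides with its Euclidean dual. -/
def IsSelfDual (C : Submodule F (Fin n → F)) : Prop :=
  C = dualCode C

/-- The distance `d(v, C)`, the minimum of `d(v, x)` over the codewords `x` (a code contains `0`,
so the minimum is over a nonempty set). -/
noncomputable def distToCode (C : Submodule F (Fin n → F)) (v : Fin n → F) : ℕ :=
  sInf {m : ℕ | ∃ x ∈ C, hammingDist v x = m}

/-- The covering radius, the maximum of `d(v, C)` over all vectors `v`. -/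
noncomputable def coveringRadius (C : Submodule F (Fin n → F)) : ℕ :=
  Finset.univ.sup (distToCode C)

/-- `B_{v,t}`, the number of codewords at distance exactly `t` from `v`. -/
noncomputable def numAtDist (C : Submodule F (Fin n → F)) (v : Fin n → F) (t : ℕ) : ℕ :=
  Set.ncard {x : Fin n → F | x ∈ C ∧ hammingDist v x = t}

/-- `C` is completely regular: `B_{v,t}` depends only on `t` and `d(v, C)`. -/
def IsCompletelyRegular (C : Submodule F (Fin n → F)) : Prop :=
  ∀ v w : Fin n → F, distToCode C v = distToCode C w →
    ∀ t ∈ Finset.range (n + 1), numAtDist C v t = numAtDist C w t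

/-- `C` is uniformly packed in the wide sense: there are rational packing coefficients
`β_0, …, β_ρ`, where `ρ` is the covering radius, with `∑_{i=0}^{ρ} β_i B_{x,i} = 1` for all `x`. -/
def IsUPWS (C : Submodule F (Fin n → F)) : Prop :=
  ∃ β : ℕ → ℚ, ∀ x : Fin n → F,
    ∑ i ∈ Finset.range (coveringRadius C + 1), β i * (numAtDist C x i : ℚ) = 1

/-- (Monomial) equivalence of linear codes: `C'` is the image of `C` under a permutation of the
coordinates followed by multiplication of each coordinate by a nonzero scalar. -/
def IsEquivalent (C C' : Submodule F (Fin n → F)) : Prop :=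
  ∃ (σ : Equiv.Perm (Fin n)) (a : Fin n → Fˣ),
    ∀ x : Fin n → F, x ∈ C ↔ (fun i => (a i : F) * x (σ i)) ∈ C'

end MDSCode

set_option linter.unusedSectionVars false

namespace MDSCode

open Finset Module

variable {F : Type*} [Field F] [Fintype F] [DecidableEq F] {n : ℕ}

/-! ### MDS codes by weights and information sets -/

/-! Any `k` coordinates of an MDS code form an information set (`IsMDS.eq_of_eqOn`,
`IsMDS.exists_eqOn`). Duality, regularity and the classification all rest on this.

Classification: such a code has a generator matrix `(I | A)` in which all entries and 2 × 2 minors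
of `A` are nonzero, so the ratios of two rows are distinct nonzero elements. Over the field with
five elements this bounds both sides of `A` by 4. A 3 × 4 matrix is impossible: by Wilson each of
the three row quotients has entry product `-1`, while two of these products multiply to the third.
Scaling and permuting columns settles uniqueness for `k = 2`. A finite check of normal forms settles
`[6,3,4]`, and duality gives the rest.

Regularity: counting pairs of a codeword and an `s`-set on which it agrees with `v` gives binomial
moments of the numbers `B_{v,t}`. For `s ≤ k` they do not depend on `v`. In codimension 2 they
determine every `B_{v,t}` from the distance of `v`. The moment of order `k` is itself a packing
identity once the covering radius reaches `n - k`, which handles `[5,2,4]`. For `[6,2,5]` and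
`[6,3,4]`, two vectors at maximal distance with different numbers of nearest codewords refute
uniform packing. -/

/-- `C` has dimension `k`, and a nonzero codeword has weight larger than `n - k`. -/
structure IsMDS (C : Submodule F (Fin n → F)) (k : ℕ) : Prop where
  finrank_eq : finrank F C = k
  lt_weight : ∀ x ∈ C, x ≠ 0 → n < hammingNorm x + k

theorem card_filter_add_hammingDist (x y : Fin n → F) :
    #{i | x i = y i} + hammingDist x y = n := by
  have := Finset.card_filter_add_card_filter_not (s := (univ : Finset (Fin n)))
    (fun i => x i = y i)
  rw [Finset.card_univ, Fintype.card_fin] at this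
  exact this

theorem add_hammingDist_le {x y : Fin n → F} {S : Finset (Fin n)} (h : ∀ i ∈ S, x i = y i) :
    #S + hammingDist x y ≤ n := by
  have hle : #S ≤ #{i | x i = y i} := Finset.card_le_card fun i hi => by simpa using h i hi
  have := card_filter_add_hammingDist x y
  omega

theorem IsMDS.lt_dist {C : Submodule F (Fin n → F)} {k : ℕ} (h : IsMDS C k) {x y : Fin n → F}
    (hx : x ∈ C) (hy : y ∈ C) (hxy : x ≠ y) : n < hammingDist x y + k := by
  rw [hammingDist_eq_hammingNorm]
  exact h.lt_weight _ (C.add_mem (C.neg_mem hx) hy) fun h0 => hxy (neg_add_eq_zero.1 h0)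

theorem IsMDS.eq_of_eqOn {C : Submodule F (Fin n → F)} {k : ℕ} (h : IsMDS C k)
    {S : Finset (Fin n)} (hS : k ≤ #S) {x y : Fin n → F} (hx : x ∈ C) (hy : y ∈ C)
    (hxy : ∀ i ∈ S, x i = y i) : x = y := by
  by_contra hne
  have := h.lt_dist hx hy hne
  have := add_hammingDist_le hxy
  omega

/-- Restriction to `k` coordinates is injective between spaces of dimension `k`, hence onto; a
smaller `S` is first enlarged to size `k`. -/
theorem IsMDS.exists_eqOn {C : Submodule F (Fin n → F)} {k : ℕ} (h : IsMDS C k) (hk : k ≤ n)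
    {S : Finset (Fin n)} (hS : #S ≤ k) (v : Fin n → F) : ∃ x ∈ C, ∀ i ∈ S, x i = v i := by
  obtain ⟨T, hST, hT⟩ : ∃ T, S ⊆ T ∧ #T = k := by
    obtain ⟨T, h1, -, h2⟩ := Finset.exists_subsuperset_card_eq (Finset.subset_univ S) hS
      (by simpa using hk)
    exact ⟨T, h1, h2⟩
  let f : C →ₗ[F] (T → F) := (LinearMap.funLeft F F (fun i : T => (i : Fin n))).comp C.subtype
  have hf : Function.Injective f := by
    intro x y hxy
    apply Subtype.ext
    refine h.eq_of_eqOn hT.ge x.2 y.2 fun i hi => ?_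
    exact congrFun hxy ⟨i, hi⟩
  have hs : Function.Surjective f := by
    refine (LinearMap.injective_iff_surjective_of_finrank_eq_finrank ?_).1 hf
    simp [h.finrank_eq, hT]
  obtain ⟨x, hx⟩ := hs fun i => v i
  exact ⟨x, x.2, fun i hi => congrFun hx ⟨i, hST hi⟩⟩

theorem IsMDS.isLinearCode {C : Submodule F (Fin n → F)} {k d : ℕ} (h : IsMDS C k) (hk : 1 ≤ k)
    (hkn : k ≤ n) (hd : d + k = n + 1) : IsLinearCode C k d := by
  refine ⟨h.finrank_eq, ?_, ?_⟩
  · obtain ⟨i₀⟩ : Nonempty (Fin n) := ⟨⟨0, by omega⟩⟩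
    obtain ⟨S, hS⟩ : ∃ S : Finset (Fin n), #S = k := by
      obtain ⟨S, -, hS⟩ := Finset.exists_subset_card_eq (s := (univ : Finset (Fin n)))
        (n := k) (by simpa using hkn)
      exact ⟨S, hS⟩
    obtain ⟨j, hj⟩ : S.Nonempty := by
      rw [← Finset.card_pos]; omega
    -- A word equal to a unit vector on `k` coordinates has `k - 1` zeros there, so it attains the
    -- Singleton bound.
    obtain ⟨x, hx, hxS⟩ := h.exists_eqOn hkn hS.le (Pi.single j 1)
    have hx0 : x ≠ 0 := by
      rintro rfl
      simpa using hxS j hj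
    refine ⟨x, hx, 0, C.zero_mem, hx0, ?_⟩
    have h1 := h.lt_dist hx C.zero_mem hx0
    have h2 : #(S.erase j) + hammingDist x 0 ≤ n := by
      refine add_hammingDist_le fun i hi => ?_
      rw [hxS i (Finset.mem_of_mem_erase hi), Pi.single_eq_of_ne (Finset.ne_of_mem_erase hi)]
      rfl
    rw [Finset.card_erase_of_mem hj] at h2
    omega
  · rintro m ⟨x, hx, y, hy, hxy, rfl⟩
    have := h.lt_dist hx hy hxy
    omega

theorem IsLinearCode.isMDS {C : Submodule F (Fin n → F)} {k d : ℕ} (h : IsLinearCode C k d)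
    (hd : d + k = n + 1) : IsMDS C k := by
  refine ⟨h.finrank_eq, fun x hx hx0 => ?_⟩
  have := h.isLeast_dist.2 ⟨x, hx, 0, C.zero_mem, hx0, rfl⟩
  rw [hammingDist_zero_right] at this
  omega

/-! ### Duality -/

theorem mem_dualCode {C : Submodule F (Fin n → F)} {x : Fin n → F} :
    x ∈ dualCode C ↔ ∀ v ∈ C, ∑ i, x i * v i = 0 := Iff.rfl

/-- The standard inner product as a bilinear form. -/
noncomputable def dotForm (F : Type*) [Field F] (n : ℕ) : LinearMap.BilinForm F (Fin n → F) :=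
  Matrix.toBilin' 1

theorem dotForm_apply (x y : Fin n → F) : dotForm F n x y = ∑ i, x i * y i := by
  simp [dotForm, Matrix.toBilin'_apply', dotProduct]

theorem dotForm_nondegenerate : (dotForm F n).Nondegenerate :=
  Matrix.Nondegenerate.toBilin' (Matrix.nondegenerate_of_det_ne_zero (by simp))

theorem dotForm_isRefl : (dotForm F n).IsRefl := by
  intro x y h
  rw [dotForm_apply] at h ⊢
  simpa [mul_comm] using h

theorem dualCode_eq_orthogonal (C : Submodule F (Fin n → F)) :
    dualCode C = (dotForm F n).orthogonal C := by
  ext x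
  rw [mem_dualCode, LinearMap.BilinForm.mem_orthogonal_iff]
  refine forall₂_congr fun v _ => ?_
  rw [dotForm_apply]
  simp [mul_comm]

theorem dualCode_dualCode (C : Submodule F (Fin n → F)) : dualCode (dualCode C) = C := by
  rw [dualCode_eq_orthogonal, dualCode_eq_orthogonal,
    LinearMap.BilinForm.orthogonal_orthogonal dotForm_nondegenerate dotForm_isRefl]

theorem finrank_dualCode (C : Submodule F (Fin n → F)) :
    finrank F (dualCode C) = n - finrank F C := by
  rw [dualCode_eq_orthogonal, LinearMap.BilinForm.finrank_orthogonal dotForm_nondegenerate]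
  simp

/-- If a nonzero dual word `y` had weight at most `k`, some codeword would equal a unit vector on
the support of `y`, and pairing the two would give a nonzero entry of `y`. -/
theorem IsMDS.dualCode {C : Submodule F (Fin n → F)} {k r : ℕ} (h : IsMDS C k)
    (hkr : k + r = n) : IsMDS (dualCode C) r := by
  refine ⟨by rw [finrank_dualCode, h.finrank_eq]; omega, fun y hy hy0 => ?_⟩
  by_contra hlt
  refine hy0 (funext fun j => ?_)
  by_contra hj
  have hS : #{i | y i ≠ 0} ≤ k := by
    have : hammingNorm y = #{i | y i ≠ 0} := rfl
    omega
  obtain ⟨x, hx, hxS⟩ := h.exists_eqOn (by omega) hS (Pi.single j 1)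
  have h0 := hy x hx
  rw [Finset.sum_eq_single j] at h0
  · rw [hxS j (by simpa using hj)] at h0
    simp at h0
    exact hj h0
  · intro i _ hij
    by_cases hi : y i = 0
    · simp [hi]
    · rw [hxS i (by simpa using hi), Pi.single_eq_of_ne hij, mul_zero]
  · simp

theorem isMDS_dualCode_iff {C : Submodule F (Fin n → F)} {k r : ℕ} (hkr : k + r = n) :
    IsMDS (dualCode C) r ↔ IsMDS C k :=
  ⟨fun h => by simpa [dualCode_dualCode] using h.dualCode (r := k) (by omega),
    fun h => h.dualCode hkr⟩

theorem isLinearCode_iff_dualCode {C : Submodule F (Fin n → F)} {k r : ℕ} (hk : 1 ≤ k)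
    (hr : 1 ≤ r) (hkr : k + r = n) :
    IsLinearCode C k (r + 1) ↔ IsLinearCode (dualCode C) r (k + 1) :=
  ⟨fun h => ((isMDS_dualCode_iff hkr).2 (h.isMDS (by omega))).isLinearCode hr (by omega) (by omega),
    fun h => ((isMDS_dualCode_iff hkr).1 (h.isMDS (by omega))).isLinearCode hk (by omega)
      (by omega)⟩

/-! ### Monomial equivalence -/

/-- A permutation of the coordinates followed by a scaling of each of them. -/
def monomial (σ : Equiv.Perm (Fin n)) (a : Fin n → Fˣ) : (Fin n → F) ≃ₗ[F] (Fin n → F) where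
  toFun x i := a i * x (σ i)
  invFun y i := ↑(a (σ.symm i))⁻¹ * y (σ.symm i)
  map_add' x y := by ext i; simp [mul_add]
  map_smul' c x := by ext i; simp [mul_left_comm]
  left_inv x := by ext i; simp
  right_inv y := by ext i; simp

theorem monomial_apply (σ : Equiv.Perm (Fin n)) (a : Fin n → Fˣ) (x : Fin n → F) (i : Fin n) :
    monomial σ a x i = a i * x (σ i) := rfl

theorem hammingDist_monomial (σ : Equiv.Perm (Fin n)) (a : Fin n → Fˣ) (x y : Fin n → F) :
    hammingDist (monomial σ a x) (monomial σ a y) = hammingDist x y := by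
  refine Finset.card_bij (fun i _ => σ i) ?_ (fun _ _ _ _ h => σ.injective h) ?_
  · intro i hi
    simpa [monomial_apply] using hi
  · intro i hi
    exact ⟨σ.symm i, by simpa [monomial_apply] using hi, by simp⟩

theorem isEquivalent_iff {C C' : Submodule F (Fin n → F)} :
    IsEquivalent C C' ↔ ∃ (σ : Equiv.Perm (Fin n)) (a : Fin n → Fˣ),
      ∀ x, x ∈ C ↔ monomial σ a x ∈ C' := Iff.rfl

/-- With equal dimensions, one inclusion suffices. -/
theorem IsEquivalent.of_forall {C C' : Submodule F (Fin n → F)}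
    (h : finrank F C = finrank F C') (σ : Equiv.Perm (Fin n)) (a : Fin n → Fˣ)
    (hC : ∀ x ∈ C, monomial σ a x ∈ C') : IsEquivalent C C' := by
  have hle : C.map (monomial σ a : (Fin n → F) →ₗ[F] (Fin n → F)) ≤ C' := by
    rintro _ ⟨x, hx, rfl⟩
    exact hC x hx
  have heq := Submodule.eq_of_le_of_finrank_eq hle (by
    rw [← h]; exact LinearEquiv.finrank_map_eq (monomial σ a) C)
  refine isEquivalent_iff.2 ⟨σ, a, fun x => ⟨hC x, fun hx => ?_⟩⟩
  rw [← heq] at hx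
  obtain ⟨y, hy, hyx⟩ := hx
  rwa [← (monomial σ a).injective hyx]

theorem IsEquivalent.symm {C C' : Submodule F (Fin n → F)} (h : IsEquivalent C C') :
    IsEquivalent C' C := by
  obtain ⟨σ, a, h⟩ := isEquivalent_iff.1 h
  refine isEquivalent_iff.2 ⟨σ.symm, fun i => (a (σ.symm i))⁻¹, fun x => ?_⟩
  rw [h]
  exact (by rw [show monomial σ a (monomial σ.symm (fun i => (a (σ.symm i))⁻¹) x) = x from
    (monomial σ a).apply_symm_apply x])

theorem IsEquivalent.trans {C C' C'' : Submodule F (Fin n → F)} (h : IsEquivalent C C')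
    (h' : IsEquivalent C' C'') : IsEquivalent C C'' := by
  obtain ⟨σ, a, h⟩ := isEquivalent_iff.1 h
  obtain ⟨τ, b, h'⟩ := isEquivalent_iff.1 h'
  refine isEquivalent_iff.2 ⟨τ.trans σ, fun i => b i * a (τ i), fun x => ?_⟩
  rw [h, h']
  apply iff_of_eq
  congr 1
  ext i
  simp [monomial_apply, mul_assoc]

theorem IsEquivalent.dualCode {C C' : Submodule F (Fin n → F)} (h : IsEquivalent C C') :
    IsEquivalent (dualCode C) (dualCode C') := by
  obtain ⟨σ, a, h⟩ := isEquivalent_iff.1 h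
  refine isEquivalent_iff.2 ⟨σ, fun i => (a i)⁻¹, fun x => ?_⟩
  -- Inverse scalars on the dual side preserve the inner product.
  have key : ∀ v, ∑ i, monomial σ (fun i => (a i)⁻¹) x i * monomial σ a v i = ∑ i, x i * v i := by
    intro v
    rw [← Equiv.sum_comp σ (fun i => x i * v i)]
    refine Finset.sum_congr rfl fun i _ => ?_
    have : (a i : F) ≠ 0 := (a i).ne_zero
    simp only [monomial_apply, Units.val_inv_eq_inv_val]
    field_simp
  rw [mem_dualCode, mem_dualCode]
  constructor
  · intro hx w hw
    obtain ⟨v, rfl⟩ := (monomial σ a).surjective w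
    rw [key]
    exact hx v ((h v).2 hw)
  · intro hx v hv
    rw [← key]
    exact hx _ ((h v).1 hv)

theorem IsEquivalent.of_dualCode {C C' : Submodule F (Fin n → F)}
    (h : IsEquivalent (MDSCode.dualCode C) (MDSCode.dualCode C')) : IsEquivalent C C' := by
  simpa [dualCode_dualCode] using h.dualCode

theorem IsMDS.of_isEquivalent {C C' : Submodule F (Fin n → F)} {k : ℕ} (hC : IsMDS C k)
    (h : IsEquivalent C C') : IsMDS C' k := by
  obtain ⟨σ, a, h⟩ := isEquivalent_iff.1 h
  have hmap : C.map (monomial σ a : (Fin n → F) →ₗ[F] (Fin n → F)) = C' := by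
    ext y
    obtain ⟨x, rfl⟩ := (monomial σ a).surjective y
    rw [← h]
    constructor
    · rintro ⟨z, hz, hzx⟩
      rwa [← (monomial σ a).injective hzx]
    · exact fun hx => ⟨x, hx, rfl⟩
  refine ⟨?_, fun y hy hy0 => ?_⟩
  · rw [← hmap, ← hC.finrank_eq]
    exact LinearEquiv.finrank_map_eq (monomial σ a) C
  · obtain ⟨x, rfl⟩ := (monomial σ a).surjective y
    have := hC.lt_weight x ((h x).2 hy) (by rintro rfl; simp at hy0)
    rwa [← hammingDist_zero_right, ← map_zero (monomial σ a), hammingDist_monomial,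
      hammingDist_zero_right]

/-! ### Distances to a code -/

theorem exists_hammingDist_eq_distToCode (C : Submodule F (Fin n → F)) (v : Fin n → F) :
    ∃ x ∈ C, hammingDist v x = distToCode C v :=
  Nat.sInf_mem (s := {m : ℕ | ∃ x ∈ C, hammingDist v x = m}) ⟨_, 0, C.zero_mem, rfl⟩

theorem distToCode_le {C : Submodule F (Fin n → F)} {x : Fin n → F} (hx : x ∈ C)
    (v : Fin n → F) : distToCode C v ≤ hammingDist v x :=
  Nat.sInf_le ⟨x, hx, rfl⟩

theorem numAtDist_eq_zero_of_lt {C : Submodule F (Fin n → F)} {v : Fin n → F} {t : ℕ}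
    (h : t < distToCode C v) : numAtDist C v t = 0 := by
  rw [numAtDist, Set.ncard_eq_zero]
  refine Set.eq_empty_of_forall_notMem fun x hx => ?_
  have := distToCode_le hx.1 v
  have := hx.2
  omega

open Classical in
theorem numAtDist_eq_card (C : Submodule F (Fin n → F)) (v : Fin n → F) (t : ℕ) :
    numAtDist C v t = #{x | x ∈ C ∧ hammingDist v x = t} := by
  rw [numAtDist, ← Set.ncard_coe_finset]
  simp

theorem distToCode_monomial {C C' : Submodule F (Fin n → F)} {σ : Equiv.Perm (Fin n)}
    {a : Fin n → Fˣ} (h : ∀ x, x ∈ C ↔ monomial σ a x ∈ C') (v : Fin n → F) :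
    distToCode C' (monomial σ a v) = distToCode C v := by
  unfold distToCode
  congr 1
  ext m
  constructor
  · rintro ⟨y, hy, rfl⟩
    obtain ⟨x, rfl⟩ := (monomial σ a).surjective y
    exact ⟨x, (h x).2 hy, (hammingDist_monomial ..).symm⟩
  · rintro ⟨x, hx, rfl⟩
    exact ⟨_, (h x).1 hx, hammingDist_monomial ..⟩

theorem numAtDist_monomial {C C' : Submodule F (Fin n → F)} {σ : Equiv.Perm (Fin n)}
    {a : Fin n → Fˣ} (h : ∀ x, x ∈ C ↔ monomial σ a x ∈ C') (v : Fin n → F) (t : ℕ) :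
    numAtDist C' (monomial σ a v) t = numAtDist C v t := by
  unfold numAtDist
  rw [← Set.ncard_image_of_injective {x | x ∈ C ∧ _} (monomial σ a).injective]
  congr 1
  ext y
  obtain ⟨x, rfl⟩ := (monomial σ a).surjective y
  rw [(monomial σ a).injective.mem_set_image]
  simp [h, hammingDist_monomial]

theorem distToCode_le_coveringRadius (C : Submodule F (Fin n → F)) (v : Fin n → F) :
    distToCode C v ≤ coveringRadius C :=
  Finset.le_sup (f := distToCode C) (Finset.mem_univ v)

theorem IsEquivalent.coveringRadius_eq {C C' : Submodule F (Fin n → F)}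
    (h : IsEquivalent C C') : coveringRadius C = coveringRadius C' := by
  obtain ⟨σ, a, h⟩ := isEquivalent_iff.1 h
  apply le_antisymm
  · refine Finset.sup_le fun v _ => ?_
    rw [← distToCode_monomial h]
    exact distToCode_le_coveringRadius ..
  · refine Finset.sup_le fun w _ => ?_
    obtain ⟨v, rfl⟩ := (monomial σ a).surjective w
    rw [distToCode_monomial h]
    exact distToCode_le_coveringRadius ..

theorem IsUPWS.of_isEquivalent {C C' : Submodule F (Fin n → F)} (hC : IsUPWS C)
    (h : IsEquivalent C C') : IsUPWS C' := by
  obtain ⟨β, hβ⟩ := hC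
  refine ⟨β, fun w => ?_⟩
  rw [← h.coveringRadius_eq]
  obtain ⟨σ, a, h⟩ := isEquivalent_iff.1 h
  obtain ⟨v, rfl⟩ := (monomial σ a).surjective w
  simpa only [numAtDist_monomial h] using hβ v

/-- In a uniformly packed code, the vectors at distance `t` from the code have the same number of
codewords at distance `t`, if `t` is at least the covering radius. -/
theorem IsUPWS.numAtDist_eq {C : Submodule F (Fin n → F)} (hC : IsUPWS C) {t : ℕ}
    (ht : ∀ v, ∃ x ∈ C, hammingDist v x ≤ t) {v w : Fin n → F}
    (hv : ∀ x ∈ C, t ≤ hammingDist v x) (hw : ∀ x ∈ C, t ≤ hammingDist w x) :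
    numAtDist C v t = numAtDist C w t := by
  have hdist : ∀ u : Fin n → F, (∀ x ∈ C, t ≤ hammingDist u x) → distToCode C u = t := by
    intro u hu
    obtain ⟨x, hx, hxu⟩ := ht u
    obtain ⟨y, hy, hyu⟩ := exists_hammingDist_eq_distToCode C u
    have := hu y hy
    have := distToCode_le hx u
    omega
  have hρ : coveringRadius C = t := by
    apply le_antisymm
    · refine Finset.sup_le fun u _ => ?_
      obtain ⟨x, hx, hxu⟩ := ht u
      exact (distToCode_le hx u).trans hxu
    · rw [← hdist v hv]
      exact distToCode_le_coveringRadius C v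
  obtain ⟨β, hβ⟩ := hC
  -- There are no codewords closer than `t`, so only the last term of the packing identity survives.
  have key : ∀ u : Fin n → F, (∀ x ∈ C, t ≤ hammingDist u x) →
      β t * (numAtDist C u t : ℚ) = 1 := by
    intro u hu
    rw [← hβ u, hρ, Finset.sum_range_succ, Finset.sum_eq_zero, zero_add]
    intro i hi
    rw [numAtDist_eq_zero_of_lt (by rw [hdist u hu]; exact Finset.mem_range.1 hi)]
    simp
  have hβt : β t ≠ 0 := by
    intro h0
    simpa [h0] using key v hv
  exact_mod_cast mul_left_cancel₀ hβt ((key v hv).trans (key w hw).symm)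

/-! ### Binomial moments of the distance distribution -/

open Classical in
-- Double counting of pairs `(x, S)` with `x` agreeing with `v` on `S`: a word at distance `t`
-- agrees in `n - t` places.
theorem sum_numAtDist_mul_choose (C : Submodule F (Fin n → F)) (v : Fin n → F) (s : ℕ) :
    ∑ t ∈ range (n + 1), numAtDist C v t * (n - t).choose s =
      ∑ S ∈ powersetCard s (univ : Finset (Fin n)), #{x | x ∈ C ∧ ∀ i ∈ S, x i = v i} := by
  have hx : ∀ x : Fin n → F, (n - hammingDist v x).choose s =
      #{S ∈ powersetCard s (univ : Finset (Fin n)) | ∀ i ∈ S, x i = v i} := by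
    intro x
    have h1 := card_filter_add_hammingDist v x
    rw [show n - hammingDist v x = #{i | v i = x i} by omega, ← Finset.card_powersetCard]
    congr 1
    ext S
    simp only [Finset.mem_powersetCard, Finset.mem_filter, true_and,
      Finset.subset_iff, Finset.mem_univ, eq_comm (a := v _)]
    tauto
  calc ∑ t ∈ range (n + 1), numAtDist C v t * (n - t).choose s
      = ∑ t ∈ range (n + 1), ∑ x ∈ {x ∈ {x | x ∈ C} | hammingDist v x = t},
          (n - hammingDist v x).choose s := by
        refine Finset.sum_congr rfl fun t _ => ?_
        rw [Finset.sum_congr rfl (g := fun _ => (n - t).choose s), Finset.sum_const,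
          numAtDist_eq_card, Finset.filter_filter, smul_eq_mul]
        intro x hx
        rw [(Finset.mem_filter.1 hx).2]
    _ = ∑ x ∈ {x | x ∈ C}, (n - hammingDist v x).choose s := by
        refine Finset.sum_fiberwise_of_maps_to (fun x _ => ?_) _
        rw [Finset.mem_range, Nat.lt_succ_iff]
        simpa using hammingDist_le_card_fintype (x := v) (y := x)
    _ = ∑ x ∈ {x | x ∈ C}, ∑ S ∈ powersetCard s (univ : Finset (Fin n)),
          if ∀ i ∈ S, x i = v i then 1 else 0 := by
        refine Finset.sum_congr rfl fun x _ => ?_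
        rw [hx, Finset.card_filter]
    _ = _ := by
        rw [Finset.sum_comm]
        refine Finset.sum_congr rfl fun S _ => ?_
        rw [← Finset.card_filter, Finset.filter_filter]

open Classical in
-- Translate by a codeword that agrees with `v` on `S`.
theorem IsMDS.card_eqOn {C : Submodule F (Fin n → F)} {k : ℕ} (h : IsMDS C k) (hk : k ≤ n)
    {S : Finset (Fin n)} (hS : #S ≤ k) (v : Fin n → F) :
    #{x | x ∈ C ∧ ∀ i ∈ S, x i = v i} = #{x | x ∈ C ∧ ∀ i ∈ S, x i = 0} := by
  obtain ⟨c, hc, hcv⟩ := h.exists_eqOn hk hS v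
  refine Finset.card_bij (fun x _ => x - c) ?_ (fun _ _ _ _ h => sub_left_injective h) ?_
  · intro x hx
    simp only [Finset.mem_filter, Finset.mem_univ, true_and] at hx ⊢
    refine ⟨C.sub_mem hx.1 hc, fun i hi => ?_⟩
    rw [Pi.sub_apply, hx.2 i hi, hcv i hi, sub_self]
  · intro x hx
    simp only [Finset.mem_filter, Finset.mem_univ, true_and] at hx
    refine ⟨x + c, ?_, by simp⟩
    simp only [Finset.mem_filter, Finset.mem_univ, true_and]
    refine ⟨C.add_mem hx.1 hc, fun i hi => ?_⟩
    rw [Pi.add_apply, hx.2 i hi, hcv i hi, zero_add]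

theorem IsMDS.sum_numAtDist_mul_choose_eq {C : Submodule F (Fin n → F)} {k : ℕ}
    (h : IsMDS C k) (hk : k ≤ n) {s : ℕ} (hs : s ≤ k) (v w : Fin n → F) :
    ∑ t ∈ range (n + 1), numAtDist C v t * (n - t).choose s =
      ∑ t ∈ range (n + 1), numAtDist C w t * (n - t).choose s := by
  classical
  rw [sum_numAtDist_mul_choose, sum_numAtDist_mul_choose]
  refine Finset.sum_congr rfl fun S hS => ?_
  have hS' : #S ≤ k := by rw [(Finset.mem_powersetCard.1 hS).2]; exact hs
  rw [h.card_eqOn hk hS' v, h.card_eqOn hk hS' w]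

theorem IsMDS.sum_numAtDist_mul_choose_self {C : Submodule F (Fin n → F)} {k : ℕ}
    (h : IsMDS C k) (hk : k ≤ n) (v : Fin n → F) :
    ∑ t ∈ range (n + 1), numAtDist C v t * (n - t).choose k = n.choose k := by
  classical
  rw [sum_numAtDist_mul_choose, Finset.sum_congr rfl (g := fun _ => 1), Finset.sum_const,
    Finset.card_powersetCard, Finset.card_univ, Fintype.card_fin, smul_eq_mul, mul_one]
  intro S hS
  have hS' : #S = k := (Finset.mem_powersetCard.1 hS).2
  obtain ⟨c, hc, hcv⟩ := h.exists_eqOn hk hS'.le v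
  rw [Finset.card_eq_one]
  refine ⟨c, ?_⟩
  ext x
  simp only [Finset.mem_filter, Finset.mem_univ, true_and, Finset.mem_singleton]
  constructor
  · rintro ⟨hx, hxv⟩
    exact h.eq_of_eqOn hS'.ge hx hc fun i hi => by rw [hxv i hi, hcv i hi]
  · rintro rfl
    exact ⟨hc, hcv⟩

/-- In a code with minimum distance at least `3`, there is at most one codeword at distance at
most `1` from a given vector. -/
theorem numAtDist_of_le_one {C : Submodule F (Fin n → F)}
    (h : ∀ x ∈ C, ∀ y ∈ C, x ≠ y → 3 ≤ hammingDist x y) (v : Fin n → F) {t : ℕ} (ht : t ≤ 1) :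
    numAtDist C v t = if distToCode C v = t then 1 else 0 := by
  obtain ⟨y, hy, hyv⟩ := exists_hammingDist_eq_distToCode C v
  split_ifs with hd
  · rw [numAtDist, Set.ncard_eq_one]
    refine ⟨y, Set.eq_singleton_iff_unique_mem.2 ⟨⟨hy, by omega⟩, ?_⟩⟩
    rintro x ⟨hx, hxv⟩
    by_contra hne
    have := h x hx y hy hne
    have := hammingDist_triangle_left x y v
    omega
  · rw [numAtDist, Set.ncard_eq_zero]
    refine Set.eq_empty_of_forall_notMem ?_
    rintro x ⟨hx, hxv⟩
    have hle := distToCode_le hx v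
    by_cases hxy : x = y
    · subst hxy; omega
    have := h x hx y hy hxy
    have := hammingDist_triangle_left x y v
    omega

/-- MDS codes of codimension `2` are completely regular. -/
theorem IsMDS.isCompletelyRegular {C : Submodule F (Fin n → F)} {k : ℕ} (h : IsMDS C k)
    (hk : k + 2 = n) : IsCompletelyRegular C := by
  intro v w hvw t ht
  rw [Finset.mem_range, Nat.lt_succ_iff] at ht
  induction t using Nat.strong_induction_on with
  | _ t ih =>
    rcases le_or_gt t 1 with h1 | h1
    · have hd : ∀ x ∈ C, ∀ y ∈ C, x ≠ y → 3 ≤ hammingDist x y := by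
        intro x hx y hy hxy
        have := h.lt_dist hx hy hxy
        omega
      rw [numAtDist_of_le_one hd v h1, numAtDist_of_le_one hd w h1, hvw]
    -- The moment of order `n - t ≤ k` involves only distances up to `t`, with coefficient 1 at `t`,
    -- so the system is triangular.
    · have hsum : ∀ u : Fin n → F, ∑ j ∈ range (n + 1), numAtDist C u j * (n - j).choose (n - t) =
          ∑ j ∈ range t, numAtDist C u j * (n - j).choose (n - t) + numAtDist C u t := by
        intro u
        have hsub : range (t + 1) ⊆ range (n + 1) := Finset.range_mono (by omega)
        rw [← Finset.sum_subset hsub, Finset.sum_range_succ, Nat.choose_self, mul_one]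
        intro j hj hj'
        rw [Finset.mem_range] at hj hj'
        rw [Nat.choose_eq_zero_of_lt (by omega), mul_zero]
      have key := h.sum_numAtDist_mul_choose_eq (by omega) (s := n - t) (by omega) v w
      rw [hsum, hsum, Finset.sum_congr rfl fun j hj => ?_] at key
      · exact Nat.add_left_cancel key
      · have hj := Finset.mem_range.1 hj
        rw [ih j hj (by omega)]

/-- An MDS code of dimension `k` and covering radius at least `n - k` is uniformly packed. -/
theorem IsMDS.isUPWS {C : Submodule F (Fin n → F)} {k : ℕ} (h : IsMDS C k) (hk0 : 1 ≤ k)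
    (hk : k ≤ n) (hρ : n ≤ coveringRadius C + k) : IsUPWS C := by
  -- The normalized moment of order `k`; its coefficients vanish for `t > n - k`, so cutting the sum
  -- at the covering radius loses nothing.
  refine ⟨fun t => ((n - t).choose k : ℚ) / (n.choose k : ℚ), fun v => ?_⟩
  have hpos : (n.choose k : ℚ) ≠ 0 := by
    exact_mod_cast (Nat.choose_pos hk).ne'
  have hle : coveringRadius C ≤ n := by
    refine Finset.sup_le fun u _ => (distToCode_le C.zero_mem u).trans ?_
    simpa using hammingDist_le_card_fintype (x := u) (y := 0)
  have hsub : range (coveringRadius C + 1) ⊆ range (n + 1) := Finset.range_mono (by omega)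
  rw [Finset.sum_subset hsub]
  · have key : (∑ t ∈ range (n + 1), (numAtDist C v t : ℚ) * ((n - t).choose k : ℚ)) =
        n.choose k := by
      exact_mod_cast h.sum_numAtDist_mul_choose_self hk v
    rw [Finset.sum_congr rfl (g := fun t => (numAtDist C v t : ℚ) * ((n - t).choose k : ℚ) /
      (n.choose k : ℚ)) (fun t _ => by ring), ← Finset.sum_div, key, div_self hpos]
  · intro t _ ht
    rw [Finset.mem_range] at ht
    simp [Nat.choose_eq_zero_of_lt (show n - t < k by omega)]

/-! ### Codes with a systematic generator matrix -/

/-- The codeword `(m, m A)`. -/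
def encode {k r : ℕ} (A : Matrix (Fin k) (Fin r) F) : (Fin k → F) →ₗ[F] (Fin (k + r) → F) where
  toFun m := Fin.append m (Matrix.vecMul m A)
  map_add' x y := by
    ext i
    refine Fin.addCases (fun i => ?_) (fun i => ?_) i <;> simp [Matrix.add_vecMul]
  map_smul' c x := by
    ext i
    refine Fin.addCases (fun i => ?_) (fun i => ?_) i <;> simp [Matrix.smul_vecMul]

variable {k r : ℕ}

@[simp] theorem encode_castAdd (A : Matrix (Fin k) (Fin r) F) (m : Fin k → F) (i : Fin k) :
    encode A m (Fin.castAdd r i) = m i := by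
  simp [encode]

@[simp] theorem encode_natAdd (A : Matrix (Fin k) (Fin r) F) (m : Fin k → F) (j : Fin r) :
    encode A m (Fin.natAdd k j) = Matrix.vecMul m A j := by
  simp [encode]

theorem encode_injective (A : Matrix (Fin k) (Fin r) F) : Function.Injective (encode A) := by
  intro x y h
  ext i
  simpa using congrFun h (Fin.castAdd r i)

/-- The code with generator matrix `(I | A)`. -/
def codeOf (A : Matrix (Fin k) (Fin r) F) : Submodule F (Fin (k + r) → F) :=
  LinearMap.range (encode A)

theorem finrank_codeOf (A : Matrix (Fin k) (Fin r) F) : finrank F (codeOf A) = k := by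
  rw [codeOf, LinearMap.finrank_range_of_inj (encode_injective A)]
  simp

theorem encode_mem_codeOf (A : Matrix (Fin k) (Fin r) F) (m : Fin k → F) :
    encode A m ∈ codeOf A := LinearMap.mem_range_self _ m

theorem mem_codeOf_iff {A : Matrix (Fin k) (Fin r) F} {v : Fin (k + r) → F} :
    v ∈ codeOf A ↔
      ∀ j, v (Fin.natAdd k j) = Matrix.vecMul (fun i => v (Fin.castAdd r i)) A j := by
  constructor
  · rintro ⟨m, rfl⟩ j
    simp
  · intro h
    refine ⟨fun i => v (Fin.castAdd r i), ?_⟩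
    ext i
    refine Fin.addCases (fun i => ?_) (fun j => ?_) i
    · simp
    · simp [h]

theorem hammingNorm_fin_add (v : Fin (k + r) → F) :
    hammingNorm v = hammingNorm (fun i => v (Fin.castAdd r i)) +
      hammingNorm (fun j => v (Fin.natAdd k j)) := by
  simp only [hammingNorm, Finset.card_filter, Fin.sum_univ_add]

theorem isMDS_codeOf_iff {A : Matrix (Fin k) (Fin r) F} :
    IsMDS (codeOf A) k ↔ ∀ m, m ≠ 0 → r < hammingNorm m + hammingNorm (Matrix.vecMul m A) := by
  have hw : ∀ m, hammingNorm (encode A m) = hammingNorm m + hammingNorm (Matrix.vecMul m A) := by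
    intro m
    simp [hammingNorm_fin_add (encode A m)]
  constructor
  · intro h m hm
    have := h.lt_weight _ (encode_mem_codeOf A m) fun h0 =>
      hm (encode_injective A (by rw [h0, map_zero]))
    rw [hw] at this
    omega
  · refine fun h => ⟨finrank_codeOf A, ?_⟩
    rintro _ ⟨m, rfl⟩ hm
    have := h m (by rintro rfl; simp at hm)
    rw [hw]
    omega

/-- The first `k` coordinates are an information set; the rows are the codewords restricting to unit
vectors there. -/
theorem IsMDS.exists_eq_codeOf {C : Submodule F (Fin (k + r) → F)} (h : IsMDS C k) :
    ∃ A : Matrix (Fin k) (Fin r) F, C = codeOf A := by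
  have hS : #((univ : Finset (Fin k)).map (Fin.castAddEmb r)) = k := by simp
  have hex : ∀ i₀ : Fin k, ∃ g ∈ C, ∀ i : Fin k, g (Fin.castAdd r i) =
      (Pi.single i₀ 1 : Fin k → F) i := by
    intro i₀
    obtain ⟨g, hg, hgS⟩ := h.exists_eqOn (by omega) hS.le
      (Fin.append (Pi.single i₀ (1 : F)) 0)
    refine ⟨g, hg, fun i => ?_⟩
    rw [hgS _ (by simp)]
    simp
  choose g hg hgi using hex
  refine ⟨Matrix.of fun i j => g i (Fin.natAdd k j), Eq.symm ?_⟩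
  refine Submodule.eq_of_le_of_finrank_eq ?_ (by rw [finrank_codeOf, h.finrank_eq])
  rintro _ ⟨m, rfl⟩
  have : encode (Matrix.of fun i j => g i (Fin.natAdd k j)) m = ∑ i, m i • g i := by
    ext i
    refine Fin.addCases (fun i => ?_) (fun j => ?_) i
    · simp [hgi, Pi.single_apply]
    · simp [Matrix.vecMul, dotProduct]
  rw [this]
  exact C.sum_mem fun i _ => C.smul_mem _ (hg i)

theorem add_hammingNorm_le {x : Fin n → F} {S : Finset (Fin n)} (h : ∀ i ∈ S, x i = 0) :
    #S + hammingNorm x ≤ n := by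
  rw [← hammingDist_zero_right]
  exact add_hammingDist_le h

theorem hammingNorm_le_card {x : Fin n → F} {S : Finset (Fin n)} (h : ∀ i, i ∉ S → x i = 0) :
    hammingNorm x ≤ #S := by
  refine Finset.card_le_card fun i hi => ?_
  by_contra hiS
  exact (Finset.mem_filter.1 hi).2 (h i hiS)

/-- A zero entry would leave a row of `(I | A)` with weight at most `1 + (r - 1)`. -/
theorem IsMDS.entry_ne_zero {A : Matrix (Fin k) (Fin r) F} (h : IsMDS (codeOf A) k)
    (i : Fin k) (j : Fin r) : A i j ≠ 0 := by
  intro h0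
  have h1 := isMDS_codeOf_iff.1 h (Pi.single i 1) (by simp)
  have h2 : hammingNorm (Pi.single i (1 : F)) ≤ #{i} :=
    hammingNorm_le_card fun l hl => Pi.single_eq_of_ne (by simpa using hl) _
  have h3 : #{j} + hammingNorm (Matrix.vecMul (Pi.single i (1 : F)) A) ≤ r :=
    add_hammingNorm_le fun l hl => by
      rw [Finset.mem_singleton] at hl
      simp [hl, h0]
  rw [Finset.card_singleton] at h2 h3
  omega

/-- A vanishing minor lets a combination of two rows vanish in two columns of `A`, giving weight at
most `2 + (r - 2)`. -/
theorem IsMDS.minor_ne_zero {A : Matrix (Fin k) (Fin r) F} (h : IsMDS (codeOf A) k)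
    {i i' : Fin k} {j j' : Fin r} (hi : i ≠ i') (hj : j ≠ j') :
    A i j * A i' j' ≠ A i j' * A i' j := by
  intro h0
  have hm0 : Pi.single i (A i' j) - Pi.single i' (A i j) ≠ (0 : Fin k → F) := by
    intro h1
    have := congrFun h1 i
    simp [hi, h.entry_ne_zero] at this
  have h1 := isMDS_codeOf_iff.1 h _ hm0
  have h2 : hammingNorm (Pi.single i (A i' j) - Pi.single i' (A i j) : Fin k → F) ≤ #{i, i'} :=
    hammingNorm_le_card fun l hl => by
      simp only [Finset.mem_insert, Finset.mem_singleton, not_or] at hl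
      simp [hl]
  have h3 : #{j, j'} + hammingNorm (Matrix.vecMul
      (Pi.single i (A i' j) - Pi.single i' (A i j) : Fin k → F) A) ≤ r :=
    add_hammingNorm_le fun l hl => by
      rw [Finset.mem_insert, Finset.mem_singleton] at hl
      rw [Matrix.sub_vecMul]
      rcases hl with rfl | rfl
      · simp [mul_comm]
      · simp only [Pi.sub_apply, Matrix.single_vecMul, Pi.smul_apply, Matrix.row_apply, smul_eq_mul]
        linear_combination -h0
  rw [Finset.card_pair hi] at h2
  rw [Finset.card_pair hj] at h3
  omega

theorem isEquivalent_codeOf_scale (A : Matrix (Fin k) (Fin r) F) (u : Fin k → Fˣ)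
    (w : Fin r → Fˣ) :
    IsEquivalent (codeOf A) (codeOf (Matrix.of fun i j => u i * A i j * w j)) := by
  refine IsEquivalent.of_forall (by rw [finrank_codeOf, finrank_codeOf]) (Equiv.refl _)
    (Fin.append (fun i => (u i)⁻¹) w) ?_
  rintro _ ⟨m, rfl⟩
  rw [mem_codeOf_iff]
  intro j
  simp only [monomial_apply, Equiv.refl_apply, Fin.append_right, Fin.append_left, encode_natAdd,
    encode_castAdd, Matrix.vecMul, dotProduct, Matrix.of_apply, Finset.mul_sum]
  refine Finset.sum_congr rfl fun i _ => ?_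
  have : (u i : F) ≠ 0 := (u i).ne_zero
  simp only [Units.val_inv_eq_inv_val]
  field_simp

theorem isEquivalent_codeOf_submatrix (A : Matrix (Fin k) (Fin r) F)
    (τ : Equiv.Perm (Fin r)) : IsEquivalent (codeOf A) (codeOf (A.submatrix id τ)) := by
  refine IsEquivalent.of_forall (by rw [finrank_codeOf, finrank_codeOf])
    (finSumFinEquiv.permCongr (Equiv.sumCongr (Equiv.refl _) τ)) 1 ?_
  rintro _ ⟨m, rfl⟩
  rw [mem_codeOf_iff]
  intro j
  simp [monomial_apply, Equiv.permCongr_apply, Matrix.vecMul, dotProduct]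

end MDSCode

namespace MDSCode

open Finset Module

/-! ### Reduction of statements about `codeOf A` to finite checks -/

section

variable {F : Type*} [Field F] [Fintype F] [DecidableEq F] {k r : ℕ}

/-- A generator matrix is mapped into a code by an explicitly given monomial map. -/
theorem isEquivalent_codeOf_of_check {A B : Matrix (Fin k) (Fin r) F}
    (p q : Fin (k + r) → Fin (k + r)) (a b : Fin (k + r) → F)
    (hpq : ∀ i, q (p i) = i ∧ p (q i) = i) (hab : ∀ i, a i * b i = 1)
    (h : ∀ m j, a (Fin.natAdd k j) * encode A m (p (Fin.natAdd k j)) =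
      Matrix.vecMul (fun i => a (Fin.castAdd r i) * encode A m (p (Fin.castAdd r i))) B j) :
    IsEquivalent (codeOf A) (codeOf B) := by
  refine IsEquivalent.of_forall (by rw [finrank_codeOf, finrank_codeOf])
    ⟨p, q, fun i => (hpq i).1, fun i => (hpq i).2⟩
    (fun i => ⟨a i, b i, hab i, by rw [mul_comm, hab i]⟩) ?_
  rintro _ ⟨m, rfl⟩
  exact mem_codeOf_iff.2 (h m)

/-- Here `s` is the syndrome of `v`: covering only has to be checked on `r` coordinates. -/
theorem exists_codeword_hammingDist_le {A : Matrix (Fin k) (Fin r) F} {t : ℕ}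
    (h : ∀ s : Fin r → F, ∃ m, hammingNorm m + hammingNorm (s + Matrix.vecMul m A) ≤ t)
    (v : Fin (k + r) → F) : ∃ x ∈ codeOf A, hammingDist v x ≤ t := by
  obtain ⟨m, hm⟩ := h ((fun j => v (Fin.natAdd k j)) -
    Matrix.vecMul (fun i => v (Fin.castAdd r i)) A)
  refine ⟨_, encode_mem_codeOf A ((fun i => v (Fin.castAdd r i)) - m), ?_⟩
  rw [hammingDist_comm, hammingDist_eq_hammingNorm, hammingNorm_fin_add]
  convert hm using 2
  · congr 1
    ext i
    simp
  · congr 1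
    ext j
    simp
    ring

theorem numAtDist_codeOf (A : Matrix (Fin k) (Fin r) F) (v : Fin (k + r) → F) (t : ℕ) :
    numAtDist (codeOf A) v t = #{m | hammingDist v (encode A m) = t} := by
  rw [numAtDist, ← Set.ncard_coe_finset, ← Set.ncard_image_of_injective _ (encode_injective A)]
  congr 1
  ext x
  constructor
  · rintro ⟨⟨m, rfl⟩, hm⟩
    exact ⟨m, by simpa using hm, rfl⟩
  · rintro ⟨m, hm, rfl⟩
    exact ⟨encode_mem_codeOf A m, by simpa using hm⟩

/-- The Gram matrix of the rows of `(I | A)` is `1 + A * A.transpose`, and the dimension is half the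
length. -/
theorem isSelfDual_codeOf {A : Matrix (Fin k) (Fin k) F} (h : A * A.transpose = -1) :
    IsSelfDual (codeOf A) := by
  refine Submodule.eq_of_le_of_finrank_eq ?_ (by rw [finrank_dualCode, finrank_codeOf]; omega)
  rintro _ ⟨x, rfl⟩
  rw [mem_dualCode]
  rintro _ ⟨y, rfl⟩
  have h1 : Matrix.vecMul x A ⬝ᵥ Matrix.vecMul y A = - (x ⬝ᵥ y) := by
    rw [← Matrix.dotProduct_mulVec, ← Matrix.mulVec_transpose A y, Matrix.mulVec_mulVec, h,
      Matrix.neg_mulVec, Matrix.one_mulVec, dotProduct_neg]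
  simp only [dotProduct] at h1
  simp only [Fin.sum_univ_add, encode_castAdd, encode_natAdd, h1, add_neg_cancel]

end

/-! ### Superregular matrices over the field with five elements -/

theorem ratio_injective {α β : Type*} {M : α → β → ZMod 5} (hM : ∀ i j, M i j ≠ 0)
    (hM' : ∀ i i' j j', i ≠ i' → j ≠ j' → M i j * M i' j' ≠ M i j' * M i' j)
    {i i' : α} (hi : i ≠ i') : Function.Injective fun j => M i j / M i' j := by
  intro j j' hj
  by_contra hne
  rw [div_eq_div_iff (hM i' j) (hM i' j')] at hj
  exact hM' i i' j j' hi hne hj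

theorem card_le_four_of_injective {β : Type*} [Fintype β] {f : β → ZMod 5}
    (hf : Function.Injective f) (h0 : ∀ j, f j ≠ 0) : Fintype.card β ≤ 4 := by
  have := Fintype.card_le_of_injective (fun j => Units.mk0 (f j) (h0 j)) fun j j' h =>
    hf (congrArg Units.val h)
  rwa [ZMod.card_units] at this

set_option synthInstance.maxHeartbeats 400000 in
set_option synthInstance.maxSize 1000 in
-- Wilson's theorem: the values are all four units.
theorem prod_eq_of_injective {f : Fin 4 → ZMod 5} (hf : Function.Injective f)
    (h0 : ∀ j, f j ≠ 0) : ∏ j, f j = -1 := by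
  have key : ∀ a b c d : ZMod 5, a ≠ 0 → b ≠ 0 → c ≠ 0 → d ≠ 0 → a ≠ b → a ≠ c → a ≠ d →
      b ≠ c → b ≠ d → c ≠ d → a * b * c * d = -1 := by decide +kernel
  rw [Fin.prod_univ_four]
  apply key <;> first | exact h0 _ | exact fun h => absurd (hf h) (by decide)

theorem not_three_by_four {M : Fin 3 → Fin 4 → ZMod 5} (hM : ∀ i j, M i j ≠ 0)
    (hM' : ∀ i i' j j', i ≠ i' → j ≠ j' → M i j * M i' j' ≠ M i j' * M i' j) : False := by
  have h : ∀ i i', i ≠ i' → ∏ j, M i j / M i' j = -1 := fun i i' hi =>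
    prod_eq_of_injective (ratio_injective hM hM' hi) fun j => div_ne_zero (hM i j) (hM i' j)
  have h1 := h 0 1 (by decide)
  have h2 := h 1 2 (by decide)
  have h3 := h 0 2 (by decide)
  -- Multiplicativity of the quotients forces `-1 = (-1) * (-1)`.
  have h4 : ∏ j, M 0 j / M 2 j = (∏ j, M 0 j / M 1 j) * ∏ j, M 1 j / M 2 j := by
    rw [← Finset.prod_mul_distrib]
    exact Finset.prod_congr rfl fun j _ => (div_mul_div_cancel₀ (hM 1 j)).symm
  rw [h1, h2, h3] at h4
  exact absurd h4 (by decide)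

theorem IsMDS.parameters {k r : ℕ} {C : Submodule (ZMod 5) (Fin (k + r) → ZMod 5)}
    (h : IsMDS C k) (hk : 2 ≤ k) (hr : 2 ≤ r) :
    k ≤ 4 ∧ r ≤ 4 ∧ ¬ (3 ≤ k ∧ 4 ≤ r) ∧ ¬ (4 ≤ k ∧ 3 ≤ r) := by
  obtain ⟨A, rfl⟩ := h.exists_eq_codeOf
  have h1 : ∀ i j, A i j ≠ 0 := h.entry_ne_zero
  have h2 : ∀ i i' j j', i ≠ i' → j ≠ j' → A i j * A i' j' ≠ A i j' * A i' j :=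
    fun i i' j j' hi hj => h.minor_ne_zero hi hj
  have h1' : ∀ j i, A i j ≠ 0 := fun j i => h1 i j
  have h2' : ∀ j j' i i', j ≠ j' → i ≠ i' → A i j * A i' j' ≠ A i' j * A i j' :=
    fun j j' i i' hj hi h0 => h2 i i' j j' hi hj (by rw [h0, mul_comm])
  refine ⟨?_, ?_, ?_, ?_⟩
  · have hj : (⟨0, by omega⟩ : Fin r) ≠ ⟨1, by omega⟩ := by simp
    have := card_le_four_of_injective (ratio_injective (M := fun j i => A i j) h1' h2' hj)
      fun i => div_ne_zero (h1 _ _) (h1 _ _)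
    simpa using this
  · have hi : (⟨0, by omega⟩ : Fin k) ≠ ⟨1, by omega⟩ := by simp
    have := card_le_four_of_injective (ratio_injective (M := A) h1 h2 hi)
      fun i => div_ne_zero (h1 _ _) (h1 _ _)
    simpa using this
  · rintro ⟨hk3, hr4⟩
    exact not_three_by_four (M := fun i j => A (Fin.castLE hk3 i) (Fin.castLE hr4 j))
      (fun _ _ => h1 _ _) fun i i' j j' hi hj => h2 _ _ _ _ (by simpa using hi) (by simpa using hj)
  · rintro ⟨hk4, hr3⟩
    exact not_three_by_four (M := fun j i => A (Fin.castLE hk4 i) (Fin.castLE hr3 j))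
      (fun _ _ => h1 _ _) fun i i' j j' hi hj => h2' _ _ _ _ (by simpa using hi) (by simpa using hj)

/-! ### Uniqueness in dimension two -/

/-- The matrix with first row `(1, …, 1)` and second row `c`. -/
def twoRow {r : ℕ} (c : Fin r → ZMod 5) : Matrix (Fin 2) (Fin r) (ZMod 5) :=
  Matrix.of ![fun _ => 1, c]

/-- Scaling columns makes the first row constant 1; the second row then consists of ratios. -/
theorem IsMDS.exists_isEquivalent_twoRow {r : ℕ} {C : Submodule (ZMod 5) (Fin (2 + r) → ZMod 5)}
    (h : IsMDS C 2) : ∃ b : Fin r → ZMod 5, Function.Injective b ∧ (∀ j, b j ≠ 0) ∧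
      IsEquivalent C (codeOf (twoRow b)) := by
  obtain ⟨A, rfl⟩ := h.exists_eq_codeOf
  refine ⟨fun j => A 1 j / A 0 j, ratio_injective h.entry_ne_zero
    (fun i i' j j' hi hj => h.minor_ne_zero hi hj) (by decide),
    fun j => div_ne_zero (h.entry_ne_zero _ _) (h.entry_ne_zero _ _), ?_⟩
  convert isEquivalent_codeOf_scale A (fun _ => 1)
    (fun j => (Units.mk0 (A 0 j) (h.entry_ne_zero 0 j))⁻¹) using 2
  ext i j
  have := h.entry_ne_zero 0 j
  fin_cases i
  · simp [twoRow, this]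
  · simp [twoRow, div_eq_mul_inv]

theorem isEquivalent_twoRow {r : ℕ} {b c : Fin r → ZMod 5} (hc : Function.Injective c)
    (h : ∃ u : (ZMod 5)ˣ, ∀ j, ∃ t, u * b t = c j) :
    IsEquivalent (codeOf (twoRow b)) (codeOf (twoRow c)) := by
  obtain ⟨u, h⟩ := h
  choose τ hτ using h
  have hinj : Function.Injective τ := fun j j' hj => hc (by rw [← hτ, ← hτ, hj])
  refine (isEquivalent_codeOf_scale (twoRow b) ![1, u] 1).trans ?_
  convert isEquivalent_codeOf_submatrix
    (Matrix.of fun i j => ((![1, u] : Fin 2 → (ZMod 5)ˣ) i : ZMod 5) * twoRow b i j *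
      ((1 : Fin r → (ZMod 5)ˣ) j : ZMod 5))
    (Equiv.ofBijective τ (Finite.injective_iff_bijective.1 hinj)) using 2
  ext i j
  fin_cases i
  · simp [twoRow]
  · simp [twoRow, hτ]

set_option synthInstance.maxHeartbeats 400000 in
set_option synthInstance.maxSize 1000 in
theorem IsMDS.isEquivalent_six_two {C : Submodule (ZMod 5) (Fin 6 → ZMod 5)} (h : IsMDS C 2) :
    IsEquivalent C (codeOf (r := 4) (twoRow ![1, 2, 3, 4])) := by
  obtain ⟨b, hb, hb0, hC⟩ := IsMDS.exists_isEquivalent_twoRow (r := 4) h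
  refine hC.trans (isEquivalent_twoRow (by decide) ⟨1, ?_⟩)
  have key : ∀ a b c d : ZMod 5, a ≠ 0 → b ≠ 0 → c ≠ 0 → d ≠ 0 → a ≠ b → a ≠ c → a ≠ d →
      b ≠ c → b ≠ d → c ≠ d → ∀ x, x ≠ 0 → a = x ∨ b = x ∨ c = x ∨ d = x := by decide +kernel
  intro j
  have hj : (![1, 2, 3, 4] : Fin 4 → ZMod 5) j ≠ 0 := by revert j; decide
  have := key (b 0) (b 1) (b 2) (b 3) (hb0 _) (hb0 _) (hb0 _) (hb0 _) (hb.ne (by decide))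
    (hb.ne (by decide)) (hb.ne (by decide)) (hb.ne (by decide)) (hb.ne (by decide))
    (hb.ne (by decide)) _ hj
  simp only [Units.val_one, one_mul]
  rcases this with h | h | h | h
  exacts [⟨_, h⟩, ⟨_, h⟩, ⟨_, h⟩, ⟨_, h⟩]

theorem IsMDS.isEquivalent_five_two {C : Submodule (ZMod 5) (Fin 5 → ZMod 5)} (h : IsMDS C 2) :
    IsEquivalent C (codeOf (r := 3) (twoRow ![1, 2, 3])) := by
  obtain ⟨b, hb, hb0, hC⟩ := IsMDS.exists_isEquivalent_twoRow (r := 3) h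
  refine hC.trans (isEquivalent_twoRow (by decide) ?_)
  -- The three entries miss one unit; `u` moves the missing one to `4`.
  have key : ∀ a b c : ZMod 5, a ≠ 0 → b ≠ 0 → c ≠ 0 → a ≠ b → a ≠ c → b ≠ c →
      ∃ u : (ZMod 5)ˣ, ∀ x, x ≠ 0 → x ≠ 4 → u * a = x ∨ u * b = x ∨ u * c = x := by
    decide +kernel
  obtain ⟨u, hu⟩ := key (b 0) (b 1) (b 2) (hb0 _) (hb0 _) (hb0 _) (hb.ne (by decide))
    (hb.ne (by decide)) (hb.ne (by decide))
  refine ⟨u, fun j => ?_⟩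
  have hj : (![1, 2, 3] : Fin 3 → ZMod 5) j ≠ 0 ∧ (![1, 2, 3] : Fin 3 → ZMod 5) j ≠ 4 := by
    revert j; decide
  rcases hu _ hj.1 hj.2 with h | h | h
  exacts [⟨_, h⟩, ⟨_, h⟩, ⟨_, h⟩]

theorem IsMDS.isEquivalent_four_two {C : Submodule (ZMod 5) (Fin 4 → ZMod 5)} (h : IsMDS C 2) :
    IsEquivalent C (codeOf (r := 2) (twoRow ![1, 2])) := by
  obtain ⟨b, hb, hb0, hC⟩ := IsMDS.exists_isEquivalent_twoRow (r := 2) h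
  refine hC.trans ?_
  -- Up to order, the ratio of the two entries is 2 or `4 = -1`.
  have key : ∀ a b : ZMod 5, a ≠ 0 → b ≠ 0 → a ≠ b →
      ∃ u : (ZMod 5)ˣ, (∀ x : ZMod 5, x = 1 ∨ x = 2 → u * a = x ∨ u * b = x) ∨
        (∀ x : ZMod 5, x = 1 ∨ x = 4 → u * a = x ∨ u * b = x) := by
    decide +kernel
  obtain ⟨u, hu | hu⟩ := key (b 0) (b 1) (hb0 _) (hb0 _) (hb.ne (by decide))
  · refine isEquivalent_twoRow (by decide) ⟨u, fun j => ?_⟩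
    have hj : (![1, 2] : Fin 2 → ZMod 5) j = 1 ∨ (![1, 2] : Fin 2 → ZMod 5) j = 2 := by
      revert j; decide
    rcases hu _ hj with h | h
    exacts [⟨_, h⟩, ⟨_, h⟩]
  · refine (isEquivalent_twoRow (c := ![1, 4]) (by decide) ⟨u, fun j => ?_⟩).trans ?_
    · have hj : (![1, 4] : Fin 2 → ZMod 5) j = 1 ∨ (![1, 4] : Fin 2 → ZMod 5) j = 4 := by
        revert j; decide
      rcases hu _ hj with h | h
      exacts [⟨_, h⟩, ⟨_, h⟩]
    -- Row scalings and column permutations keep the ratio `-1`, so an information coordinate must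
    -- be exchanged with a check coordinate.
    · exact isEquivalent_codeOf_of_check ![0, 2, 3, 1] ![0, 3, 1, 2] ![1, 2, 3, 4] ![1, 3, 2, 4]
        (by decide) (by decide) (by decide +kernel)

/-! ### Uniqueness of the `[6, 3, 4]` code -/

/-- A kernel vector would encode to a word with zero check part, of weight at most `k`. -/
theorem IsMDS.det_ne_zero {k : ℕ} {F : Type*} [Field F] [Fintype F] [DecidableEq F]
    {A : Matrix (Fin k) (Fin k) F} (h : IsMDS (codeOf A) k) : A.det ≠ 0 := by
  intro h0
  obtain ⟨m, hm, hmA⟩ := Matrix.exists_vecMul_eq_zero_iff.2 h0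
  have h1 := isMDS_codeOf_iff.1 h m hm
  have h2 : hammingNorm m ≤ k := by simpa using hammingNorm_le_card_fintype (x := m)
  rw [hmA, hammingNorm_zero] at h1
  omega

/-- The normal form of a `3 × 3` matrix without zero entries. -/
def normalForm (a b c d : ZMod 5) : Matrix (Fin 3) (Fin 3) (ZMod 5) :=
  !![1, 1, 1; 1, a, b; 1, c, d]

theorem IsMDS.exists_isEquivalent_normalForm {C : Submodule (ZMod 5) (Fin (3 + 3) → ZMod 5)}
    (h : IsMDS C 3) : ∃ a b c d, IsEquivalent C (codeOf (normalForm a b c d)) := by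
  obtain ⟨A, rfl⟩ := h.exists_eq_codeOf
  have h0 := h.entry_ne_zero
  let u : Fin 3 → (ZMod 5)ˣ := fun i => Units.mk0 (A 0 0 / A i 0) (div_ne_zero (h0 _ _) (h0 _ _))
  let w : Fin 3 → (ZMod 5)ˣ := fun j => Units.mk0 (A 0 j)⁻¹ (inv_ne_zero (h0 _ _))
  have hrow : ∀ j, 1 = u 0 * A 0 j * w j := fun j => by simp [u, w, h0]
  have hcol : ∀ i, 1 = u i * A i 0 * w 0 := fun i => by simp [u, w, h0]
  refine ⟨u 1 * A 1 1 * w 1, u 1 * A 1 2 * w 2, u 2 * A 2 1 * w 1, u 2 * A 2 2 * w 2, ?_⟩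
  convert isEquivalent_codeOf_scale A u w using 2
  ext i j
  fin_cases i <;> fin_cases j <;> first | exact hrow _ | exact hcol _ | rfl

set_option synthInstance.maxHeartbeats 400000 in
set_option synthInstance.maxSize 5000 in
set_option maxSynthPendingDepth 10 in
-- The hypotheses say that no entry, 2 × 2 minor or determinant of `normalForm a b c d` vanishes;
-- the last one is the determinant.
theorem normalForm_cases : ∀ a b c d : ZMod 5, a ≠ 0 → b ≠ 0 → c ≠ 0 → d ≠ 0 →
    a ≠ 1 → b ≠ 1 → c ≠ 1 → d ≠ 1 → a ≠ b → c ≠ d → a ≠ c → b ≠ d → a * d ≠ b * c →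
    (a - 1) * (d - 1) ≠ (b - 1) * (c - 1) →
    (a = 2 ∧ b = 3 ∧ c = 3 ∧ d = 4) ∨ (a = 2 ∧ b = 4 ∧ c = 4 ∧ d = 2) ∨
    (a = 3 ∧ b = 2 ∧ c = 4 ∧ d = 3) ∨ (a = 3 ∧ b = 4 ∧ c = 2 ∧ d = 3) ∨
    (a = 4 ∧ b = 2 ∧ c = 2 ∧ d = 4) ∨ (a = 4 ∧ b = 3 ∧ c = 3 ∧ d = 2) := by
  decide +kernel

theorem IsMDS.isEquivalent_six_three {C : Submodule (ZMod 5) (Fin 6 → ZMod 5)} (h : IsMDS C 3) :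
    IsEquivalent C (codeOf (k := 3) (r := 3) (normalForm 2 4 4 2)) := by
  obtain ⟨a, b, c, d, hC⟩ := IsMDS.exists_isEquivalent_normalForm h
  refine hC.trans ?_
  have hN := IsMDS.of_isEquivalent (n := 3 + 3) h hC
  have hm : ∀ i i' j j', i ≠ i' → j ≠ j' → normalForm a b c d i j * normalForm a b c d i' j' ≠
    normalForm a b c d i j' * normalForm a b c d i' j :=
    fun i i' j j' hi hj => hN.minor_ne_zero hi hj
  have hdet := hN.det_ne_zero
  rw [Matrix.det_fin_three] at hdet
  rcases normalForm_cases a b c d (hN.entry_ne_zero 1 1) (hN.entry_ne_zero 1 2)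
    (hN.entry_ne_zero 2 1) (hN.entry_ne_zero 2 2)
    (by simpa [normalForm] using hm 0 1 0 1 (by decide) (by decide))
    (by simpa [normalForm] using hm 0 1 0 2 (by decide) (by decide))
    (by simpa [normalForm] using hm 0 2 0 1 (by decide) (by decide))
    (by simpa [normalForm] using hm 0 2 0 2 (by decide) (by decide))
    (by simpa [normalForm, eq_comm] using hm 0 1 1 2 (by decide) (by decide))
    (by simpa [normalForm, eq_comm] using hm 0 2 1 2 (by decide) (by decide))
    (by simpa [normalForm, eq_comm] using hm 1 2 0 1 (by decide) (by decide))
    (by simpa [normalForm, eq_comm] using hm 1 2 0 2 (by decide) (by decide))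
    (by simpa [normalForm] using hm 1 2 1 2 (by decide) (by decide))
    (fun h0 => hdet (by simp [normalForm]; linear_combination h0)) with
    ⟨rfl, rfl, rfl, rfl⟩ | ⟨rfl, rfl, rfl, rfl⟩ | ⟨rfl, rfl, rfl, rfl⟩ | ⟨rfl, rfl, rfl, rfl⟩ |
    ⟨rfl, rfl, rfl, rfl⟩ | ⟨rfl, rfl, rfl, rfl⟩
  -- The six matrices differ by column permutations and row scalings: the maps permute only the last
  -- three coordinates and scale only the first three.
  · exact isEquivalent_codeOf_of_check ![0, 1, 2, 5, 3, 4] ![0, 1, 2, 4, 5, 3]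
      ![1, 3, 4, 1, 1, 1] ![1, 2, 4, 1, 1, 1] (by decide) (by decide) (by decide +kernel)
  · exact isEquivalent_codeOf_of_check ![0, 1, 2, 3, 4, 5] ![0, 1, 2, 3, 4, 5]
      ![1, 1, 1, 1, 1, 1] ![1, 1, 1, 1, 1, 1] (by decide) (by decide) (by decide +kernel)
  · exact isEquivalent_codeOf_of_check ![0, 1, 2, 4, 3, 5] ![0, 1, 2, 4, 3, 5]
      ![1, 3, 4, 1, 1, 1] ![1, 2, 4, 1, 1, 1] (by decide) (by decide) (by decide +kernel)
  · exact isEquivalent_codeOf_of_check ![0, 1, 2, 5, 4, 3] ![0, 1, 2, 5, 4, 3]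
      ![1, 4, 3, 1, 1, 1] ![1, 4, 2, 1, 1, 1] (by decide) (by decide) (by decide +kernel)
  · exact isEquivalent_codeOf_of_check ![0, 1, 2, 3, 5, 4] ![0, 1, 2, 3, 5, 4]
      ![1, 1, 1, 1, 1, 1] ![1, 1, 1, 1, 1, 1] (by decide) (by decide) (by decide +kernel)
  · exact isEquivalent_codeOf_of_check ![0, 1, 2, 4, 5, 3] ![0, 1, 2, 5, 3, 4]
      ![1, 4, 3, 1, 1, 1] ![1, 4, 2, 1, 1, 1] (by decide) (by decide) (by decide +kernel)

/-! ### Properties of the individual codes -/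

theorem isMDS_six_two : IsMDS (codeOf (r := 4) (twoRow ![1, 2, 3, 4])) 2 :=
  isMDS_codeOf_iff.2 (by decide +kernel)

theorem isMDS_five_two : IsMDS (codeOf (r := 3) (twoRow ![1, 2, 3])) 2 :=
  isMDS_codeOf_iff.2 (by decide +kernel)

theorem isMDS_four_two : IsMDS (codeOf (r := 2) (twoRow ![1, 2])) 2 :=
  isMDS_codeOf_iff.2 (by decide +kernel)

theorem not_isUPWS_six_two : ¬ IsUPWS (codeOf (r := 4) (twoRow ![1, 2, 3, 4])) := by
  intro h
  -- Both vectors lie at distance 3, the covering radius, but have different numbers of codewords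
  -- there.
  have := h.numAtDist_eq (t := 3) (exists_codeword_hammingDist_le (by decide +kernel))
    (v := ![0, 0, 0, 1, 1, 2]) (w := ![0, 0, 0, 1, 1, 3])
    (by rintro _ ⟨m, rfl⟩; revert m; decide +kernel)
    (by rintro _ ⟨m, rfl⟩; revert m; decide +kernel)
  rw [numAtDist_codeOf, numAtDist_codeOf] at this
  revert this
  decide +kernel

theorem not_isUPWS_six_three : ¬ IsUPWS (codeOf (normalForm 2 4 4 2)) := by
  intro h
  -- The same obstruction, now at covering radius 2.
  have := h.numAtDist_eq (t := 2) (exists_codeword_hammingDist_le (by decide +kernel))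
    (v := ![0, 0, 0, 0, 1, 1]) (w := ![0, 0, 0, 0, 1, 2])
    (by rintro _ ⟨m, rfl⟩; revert m; decide +kernel)
    (by rintro _ ⟨m, rfl⟩; revert m; decide +kernel)
  rw [numAtDist_codeOf, numAtDist_codeOf] at this
  revert this
  decide +kernel

/-- The bound `3 = n - k` is what `IsMDS.isUPWS` needs. Adjoining the witness to the code yields a
`[5,3,3]` code, so it stays at distance 3. -/
theorem three_le_coveringRadius_five_two :
    3 ≤ coveringRadius (codeOf (r := 3) (twoRow ![1, 2, 3])) := by
  have h : ∀ m, 3 ≤ hammingDist ![0, 0, 1, 3, 4] (encode (r := 3) (twoRow ![1, 2, 3]) m) := by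
    decide +kernel
  refine le_trans ?_ (distToCode_le_coveringRadius _ ![0, 0, 1, 3, 4])
  obtain ⟨_, ⟨m, rfl⟩, hm⟩ := exists_hammingDist_eq_distToCode
    (codeOf (r := 3) (twoRow ![1, 2, 3])) ![0, 0, 1, 3, 4]
  rw [← hm]
  exact h m

theorem exists_isMDS_isSelfDual :
    ∃ C : Submodule (ZMod 5) (Fin 6 → ZMod 5), IsMDS C 3 ∧ IsSelfDual C :=
  ⟨codeOf (k := 3) (r := 3) !![1, 2, 2; 2, 1, 3; 2, 3, 1], isMDS_codeOf_iff.2 (by decide +kernel),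
    isSelfDual_codeOf (by decide +kernel)⟩

theorem IsMDS.not_isSelfDual {C : Submodule (ZMod 5) (Fin 4 → ZMod 5)} (h : IsMDS C 2) :
    ¬ IsSelfDual C := by
  intro hC
  obtain ⟨A, rfl⟩ := IsMDS.exists_eq_codeOf (k := 2) (r := 2) h
  have hmem := encode_mem_codeOf A (Pi.single 0 1)
  have h1 : ∑ i, encode A (Pi.single 0 1) i * encode A (Pi.single 0 1) i = 0 := by
    have hmem' : encode A (Pi.single 0 1) ∈ MDSCode.dualCode (codeOf A) := hC ▸ hmem
    exact hmem' _ hmem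
  -- The first generator `(1, 0, a, b)` is not self-orthogonal: nonzero squares are `±1`, and `1 ± 1
  -- ± 1` is never 0 modulo 5.
  have key : ∀ a b : ZMod 5, a ≠ 0 → b ≠ 0 → 1 + (a * a + b * b) ≠ 0 := by decide +kernel
  refine key (A 0 0) (A 0 1) (IsMDS.entry_ne_zero h _ _) (IsMDS.entry_ne_zero h _ _) ?_
  rw [← h1, Fin.sum_univ_add]
  simp only [encode_castAdd, encode_natAdd]
  simp

/-! ### Classification of the nontrivial MDS codes -/

theorem isNontrivialMDS_iff {n k d : ℕ} {C : Submodule (ZMod 5) (Fin n → ZMod 5)} :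
    IsNontrivialMDS C k d ↔ IsMDS C k ∧ 2 ≤ k ∧ k + 2 ≤ n ∧ d + k = n + 1 :=
  ⟨fun h => ⟨h.toIsLinearCode.isMDS h.singleton_eq, h.two_le, h.add_two_le, h.singleton_eq⟩,
    fun h => ⟨h.1.isLinearCode (by omega) (by omega) h.2.2.2, h.2.1, h.2.2.1, h.2.2.2⟩⟩

theorem IsNontrivialMDS.parameters {n k d : ℕ} {C : Submodule (ZMod 5) (Fin n → ZMod 5)}
    (h : IsNontrivialMDS C k d) : (n = 6 ∧ k = 4 ∧ d = 3) ∨ (n = 6 ∧ k = 2 ∧ d = 5) ∨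
      (n = 6 ∧ k = 3 ∧ d = 4) ∨ (n = 5 ∧ k = 3 ∧ d = 3) ∨ (n = 5 ∧ k = 2 ∧ d = 4) ∨
      (n = 4 ∧ k = 2 ∧ d = 3) := by
  obtain ⟨h, h2, hn, hd⟩ := isNontrivialMDS_iff.1 h
  obtain ⟨r, rfl⟩ := Nat.exists_eq_add_of_le (show k ≤ n by omega)
  have := h.parameters h2 (by omega)
  omega

theorem IsNontrivialMDS.isEquivalent {n k d : ℕ} {C C' : Submodule (ZMod 5) (Fin n → ZMod 5)}
    (h : IsNontrivialMDS C k d) (h' : IsNontrivialMDS C' k d) : IsEquivalent C C' := by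
  have hC := (isNontrivialMDS_iff.1 h).1
  have hC' := (isNontrivialMDS_iff.1 h').1
  rcases h.parameters with ⟨rfl, rfl, rfl⟩ | ⟨rfl, rfl, rfl⟩ | ⟨rfl, rfl, rfl⟩ | ⟨rfl, rfl, rfl⟩ |
    ⟨rfl, rfl, rfl⟩ | ⟨rfl, rfl, rfl⟩
  -- Dimension 4 is reduced to dimension 2 by passing to the dual.
  · exact ((hC.dualCode (r := 2) rfl).isEquivalent_six_two.trans
      (hC'.dualCode (r := 2) rfl).isEquivalent_six_two.symm).of_dualCode
  · exact hC.isEquivalent_six_two.trans hC'.isEquivalent_six_two.symm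
  · exact hC.isEquivalent_six_three.trans hC'.isEquivalent_six_three.symm
  · exact ((hC.dualCode (r := 2) rfl).isEquivalent_five_two.trans
      (hC'.dualCode (r := 2) rfl).isEquivalent_five_two.symm).of_dualCode
  · exact hC.isEquivalent_five_two.trans hC'.isEquivalent_five_two.symm
  · exact hC.isEquivalent_four_two.trans hC'.isEquivalent_four_two.symm

theorem exists_isNontrivialMDS_iff (n k d : ℕ) :
    (∃ C : Submodule (ZMod 5) (Fin n → ZMod 5), IsNontrivialMDS C k d) ↔
      (n, k, d) ∈ ({(6, 4, 3), (6, 2, 5), (6, 3, 4), (5, 3, 3), (5, 2, 4), (4, 2, 3)} :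
        Set (ℕ × ℕ × ℕ)) := by
  simp only [Set.mem_insert_iff, Set.mem_singleton_iff, Prod.mk.injEq]
  constructor
  · rintro ⟨C, hC⟩
    exact hC.parameters
  · simp only [isNontrivialMDS_iff]
    obtain ⟨S, hS, -⟩ := exists_isMDS_isSelfDual
    rintro (⟨rfl, rfl, rfl⟩ | ⟨rfl, rfl, rfl⟩ | ⟨rfl, rfl, rfl⟩ | ⟨rfl, rfl, rfl⟩ |
      ⟨rfl, rfl, rfl⟩ | ⟨rfl, rfl, rfl⟩)
    · exact ⟨dualCode _, isMDS_six_two.dualCode (r := 4) rfl, by norm_num⟩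
    · exact ⟨_, isMDS_six_two, by norm_num⟩
    · exact ⟨S, hS, by norm_num⟩
    · exact ⟨dualCode _, isMDS_five_two.dualCode (r := 3) rfl, by norm_num⟩
    · exact ⟨_, isMDS_five_two, by norm_num⟩
    · exact ⟨_, isMDS_four_two, by norm_num⟩

end MDSCode


theorem mainTheorem1 :
    -- the parameters of the nontrivial MDS codes over the field with five elements
    -- are exactly these six, all of which occur
    (∀ n k d : ℕ,
      (∃ C : Submodule (ZMod 5) (Fin n → ZMod 5), MDSCode.IsNontrivialMDS C k d) ↔
        (n, k, d) ∈ ({(6, 4, 3), (6, 2, 5), (6, 3, 4), (5, 3, 3), (5, 2, 4), (4, 2, 3)} :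
          Set (ℕ × ℕ × ℕ))) ∧
    -- up to equivalence, there is only one code for each of them
    (∀ (n k d : ℕ) (C C' : Submodule (ZMod 5) (Fin n → ZMod 5)),
      MDSCode.IsNontrivialMDS C k d → MDSCode.IsNontrivialMDS C' k d →
        MDSCode.IsEquivalent C C') ∧
    -- the `[6,4,3]` codes and their duals, the `[6,2,5]` codes
    (∀ C : Submodule (ZMod 5) (Fin 6 → ZMod 5),
      MDSCode.IsLinearCode C 4 3 → MDSCode.IsCompletelyRegular C) ∧
    (∀ C : Submodule (ZMod 5) (Fin 6 → ZMod 5),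
      MDSCode.IsLinearCode C 4 3 ↔ MDSCode.IsLinearCode (MDSCode.dualCode C) 2 5) ∧
    (∀ C : Submodule (ZMod 5) (Fin 6 → ZMod 5),
      MDSCode.IsLinearCode C 2 5 → ¬ MDSCode.IsUPWS C) ∧
    -- the `[6,3,4]` codes
    (∀ C : Submodule (ZMod 5) (Fin 6 → ZMod 5),
      MDSCode.IsLinearCode C 3 4 → ¬ MDSCode.IsUPWS C) ∧
    (∃ C : Submodule (ZMod 5) (Fin 6 → ZMod 5),
      MDSCode.IsLinearCode C 3 4 ∧ MDSCode.IsSelfDual C) ∧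
    -- the `[5,3,3]` codes and their duals, the `[5,2,4]` codes
    (∀ C : Submodule (ZMod 5) (Fin 5 → ZMod 5),
      MDSCode.IsLinearCode C 3 3 → MDSCode.IsCompletelyRegular C) ∧
    (∀ C : Submodule (ZMod 5) (Fin 5 → ZMod 5),
      MDSCode.IsLinearCode C 3 3 ↔ MDSCode.IsLinearCode (MDSCode.dualCode C) 2 4) ∧
    (∀ C : Submodule (ZMod 5) (Fin 5 → ZMod 5),
      MDSCode.IsLinearCode C 2 4 → MDSCode.IsUPWS C) ∧
    -- the `[4,2,3]` codes
    (∀ C : Submodule (ZMod 5) (Fin 4 → ZMod 5),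
      MDSCode.IsLinearCode C 2 3 →
        MDSCode.IsCompletelyRegular C ∧ ¬ MDSCode.IsSelfDual C) := by
  refine ⟨MDSCode.exists_isNontrivialMDS_iff, fun n k d C C' h h' => h.isEquivalent h', fun C h => ?_,
    fun C => ?_, fun C h hU => ?_, fun C h hU => ?_, ?_, fun C h => ?_, fun C => ?_, fun C h => ?_,
    fun C h => ?_⟩
  · exact (h.isMDS rfl).isCompletelyRegular rfl
  · exact MDSCode.isLinearCode_iff_dualCode (k := 4) (r := 2) (by norm_num) (by norm_num) rfl
  · exact MDSCode.not_isUPWS_six_two (hU.of_isEquivalent (h.isMDS rfl).isEquivalent_six_two)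
  · exact MDSCode.not_isUPWS_six_three (hU.of_isEquivalent (h.isMDS rfl).isEquivalent_six_three)
  · obtain ⟨C, hC, hC'⟩ := MDSCode.exists_isMDS_isSelfDual
    exact ⟨C, hC.isLinearCode (by norm_num) (by norm_num) rfl, hC'⟩
  · exact (h.isMDS rfl).isCompletelyRegular rfl
  · exact MDSCode.isLinearCode_iff_dualCode (k := 3) (r := 2) (by norm_num) (by norm_num) rfl
  · have hC := h.isMDS rfl
    refine hC.isUPWS (by norm_num) (by norm_num) ?_
    have h3 := MDSCode.three_le_coveringRadius_five_two
    have := hC.isEquivalent_five_two.coveringRadius_eq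
    omega
  · exact ⟨(h.isMDS rfl).isCompletelyRegular rfl, (h.isMDS rfl).not_isSelfDual⟩
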